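/- **Proposition 23 (Kantorovich duality).** Let $d\ge 0$. Let $\mathcal M$ be the set of finite positive Borel measures on $\mathbb R^d$ and $\mathcal M^s$ the space of finite signed Borel measures on $\mathbb R^d$; for $\sigma\in\mathcal M^s$ with Jordan decomposition $(\sigma_+,\sigma_-)$ put $|\sigma|=\sigma_+(\mathbb R^d)+\sigma_-(\mathbb R^d)$. For $\alpha,\beta\in\mathcal M$ of the same mass let $W_1(\alpha,\beta)=\inf_\pi\int|x-y|\,d\pi(x,y)\in[0,\infty]$, where $\pi$ runs over the positive measures on $\mathbb R^d\times\mathbb R^d$ with marginals $\alpha$ and $\beta$. For $\alpha,\beta\in\mathcal M$ let $$W_1^{1,1}(\alpha,\beta)=\inf\bigl\{|\alpha-\tilde\alpha|+|\beta-\tilde\beta|+W_1(\tilde\alpha,\tilde\beta)\;:\;\tilde\alpha,\tilde\beta\in\mathcal M,\ |\tilde\alpha|=|\tilde\beta|\bigr\},$$ and for $\mu,\nu\in\mathcal M^s$ let $\mathbb W_1^{1,1}(\mu,\nu)=W_1^{1,1}(\mu_++\nu_-,\mu_-+\nu_+)$ and $\|\mu\|^{1,1}=\mathbb W_1^{1,1}(\mu,0)$,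 where $\mu=\mu_+-\mu_-$ and $\nu=\nu_+-\nu_-$ are the Jordan decompositions. Then for all $\mu,\nu\in\mathcal M^s$ the value $W_1^{1,1}(\mu_++\nu_-,\mu_-+\nu_+)$ is the same for all decompositions $\mu=\mu_+-\mu_-$, $\nu=\nu_+-\nu_-$ with $\mu_\pm,\nu_\pm\in\mathcal M$, it is finite, and $$\mathbb W_1^{1,1}(\mu,\nu)=\sup\Bigl\{\int_{\mathbb R^d}\varphi\,d(\mu-\nu)\;:\;\varphi:\mathbb R^d\to\mathbb R \text{ bounded and Lipschitz},\ \|\varphi\|_\infty\le1,\ \mathrm{Lip}(\varphi)\le1\Bigr\}.$$ In particular $\|\mu\|^{1,1}$ is finite and equals the bounded Lipschitz norm $\sup\{\int\varphi\,d\mu:\|\varphi\|_\infty\le1,\ \mathrm{Lip}(\varphi)\le1\}$. -/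

import Mathlib

open MeasureTheory
open scoped ENNReal NNReal BoundedContinuousFunction

noncomputable section

namespace SignedWasserstein

variable {E : Type*} [MeasurableSpace E]

/-- The difference of two finite positive measures, as a signed measure. -/
def diff (p n : FiniteMeasure E) : SignedMeasure E :=
  (p : Measure E).toSignedMeasure - (n : Measure E).toSignedMeasure

/-- The mass `|s| = s₊(E) + s₋(E)` of a signed measure, with `(s₊, s₋)` its Jordan decomposition. -/
def mass (s : SignedMeasure E) : ℝ≥0∞ := s.totalVariation Set.univ

/-- The transference plans between `μ` and `ν`: measures on `E × E` with marginals `μ` and `ν`. -/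
def plans (μ ν : FiniteMeasure E) : Set (Measure (E × E)) :=
  {π | π.map Prod.fst = (μ : Measure E) ∧ π.map Prod.snd = (ν : Measure E)}

/-- The Wasserstein distance `W₁(μ, ν)` of two finite measures of the same mass. It may be `∞`, as
no first moment is assumed. -/
def W₁ [PseudoEMetricSpace E] (μ ν : FiniteMeasure E) : ℝ≥0∞ :=
  ⨅ π ∈ plans μ ν, ∫⁻ z, edist z.1 z.2 ∂π

/-- The generalized Wasserstein distance `W₁^{a,b}(μ, ν)` of two finite positive measures: the
infimum of `a (|μ - μ'| + |ν - ν'|) + b W₁(μ', ν')` over all finite positive measures `μ'`, `ν'` of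
the same mass. -/
def genW₁ [PseudoEMetricSpace E] (a b : ℝ≥0) (μ ν : FiniteMeasure E) : ℝ≥0∞ :=
  ⨅ (μ' : FiniteMeasure E) (ν' : FiniteMeasure E) (_ : μ'.mass = ν'.mass),
    a * (mass (diff μ μ') + mass (diff ν ν')) + b * W₁ μ' ν'

/-- The positive part of the Jordan decomposition. -/
def posPart (s : SignedMeasure E) : FiniteMeasure E :=
  ⟨s.toJordanDecomposition.posPart, s.toJordanDecomposition.posPart_finite⟩

/-- The negative part of the Jordan decomposition. -/
def negPart (s : SignedMeasure E) : FiniteMeasure E :=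
  ⟨s.toJordanDecomposition.negPart, s.toJordanDecomposition.negPart_finite⟩

/-- The generalized Wasserstein distance of signed measures,
`𝕎₁^{a,b}(μ, ν) = W₁^{a,b}(μ₊ + ν₋, μ₋ + ν₊)`, computed with the Jordan decompositions. -/
def signedW₁ [PseudoEMetricSpace E] (a b : ℝ≥0) (μ ν : SignedMeasure E) : ℝ≥0∞ :=
  genW₁ a b (posPart μ + negPart ν) (negPart μ + posPart ν)

/-- The norm `‖μ‖^{a,b} = 𝕎₁^{a,b}(μ, 0)`. -/
def normW₁ [PseudoEMetricSpace E] (a b : ℝ≥0) (μ : SignedMeasure E) : ℝ≥0∞ :=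
  signedW₁ a b μ 0

/-- The bounded continuous functions with `‖φ‖_∞ ≤ 1` and Lipschitz constant at most `1`. -/
def blBall (E : Type*) [PseudoEMetricSpace E] : Set (E →ᵇ ℝ) :=
  {φ | ‖φ‖ ≤ 1 ∧ LipschitzWith 1 φ}

/-- The set of values `∫ φ ds` over the test functions of `blBall`; its supremum is the bounded
Lipschitz norm of `s`. -/
def blValues [PseudoEMetricSpace E] (s : SignedMeasure E) : Set ℝ :=
  {r | ∃ φ ∈ blBall E, r = ∫ᵛ x, φ x ∂<•s}

end SignedWasserstein

end

/-!
Let marginals be violated at the price `a` per unit of mass. The resulting transport cost makes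
sense, and is finite and sublinear, on pairs of signed measures, so the Hahn–Banach theorem gives
linear functionals `Φ` and `Ψ` with `Φ p + Ψ q` at most the cost of `(p, q)` and equality at a
prescribed pair. These functionals need not be continuous. Still, testing them on probability
measures concentrated near a point produces a `b`-Lipschitz function `f` with values in `[-a, a]`:
`f x` is the infimum, capped at `a`, of `b * r - Ψ q` over the probability measures `q` concentrated
on the ball of radius `r` about `x`. Cutting a measure into pieces of small diameter gives
`Φ p ≤ ∫ f dp` and `Ψ q ≤ -∫ f dq`, so the supremum of `∫ φ d(p - q)` equals the cost and is
attained at `f`. As this supremum depends only on `p - q`, so does the cost, which is the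
independence of the decompositions.
-/

noncomputable section

namespace SignedWasserstein

open TopologicalSpace

theorem exists_linear_le_sublinear_eq {V : Type*} [AddCommGroup V] [Module ℝ V] (N : V → ℝ)
    (N_hom : ∀ c : ℝ, 0 < c → ∀ x, N (c • x) = c * N x) (N_add : ∀ x y, N (x + y) ≤ N x + N y)
    (x₀ : V) : ∃ g : V →ₗ[ℝ] ℝ, g x₀ = N x₀ ∧ ∀ x, g x ≤ N x := by
  have N_zero : N 0 = 0 := by
    have := N_hom 2 two_pos 0
    rw [smul_zero] at this
    linarith
  have N_le (c : ℝ) : c * N x₀ ≤ N (c • x₀) := by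
    rcases lt_trichotomy c 0 with hc | rfl | hc
    · have := N_add (c • x₀) (-c • x₀)
      rw [← add_smul, add_neg_cancel, zero_smul, N_zero, N_hom _ (neg_pos.2 hc)] at this
      linarith
    · simp [N_zero]
    · exact (N_hom c hc x₀).ge
  have H (c : ℝ) (hc : c • x₀ = 0) : c • N x₀ = 0 := by
    rcases smul_eq_zero.1 hc with rfl | rfl
    · exact zero_smul ..
    · rw [N_zero, smul_zero]
  obtain ⟨g, g_ext, g_le⟩ := exists_extension_of_le_sublinear
    (LinearPMap.mkSpanSingleton' x₀ (N x₀) H) N N_hom N_add (by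
      rintro ⟨x, hx⟩
      obtain ⟨c, rfl⟩ := Submodule.mem_span_singleton.1 hx
      rw [LinearPMap.mkSpanSingleton'_apply]
      exact N_le c)
  refine ⟨g, ?_, g_le⟩
  exact (g_ext ⟨x₀, Submodule.mem_span_singleton_self x₀⟩).trans
    (LinearPMap.mkSpanSingleton'_apply_self ..)

section Mass

variable {E : Type*} [MeasurableSpace E]

/-- A finite measure seen as a signed measure, linearly over the nonnegative reals. -/
def toSigned : FiniteMeasure E →ₗ[ℝ≥0] SignedMeasure E where
  toFun p := (p : Measure E).toSignedMeasure
  map_add' p q := Measure.toSignedMeasure_add (p : Measure E) (q : Measure E)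
  map_smul' c p := Measure.toSignedMeasure_smul (p : Measure E) c

theorem diff_eq_sub (p n : FiniteMeasure E) : diff p n = toSigned p - toSigned n := rfl

theorem diff_posPart_negPart (s : SignedMeasure E) : diff (posPart s) (negPart s) = s :=
  s.toSignedMeasure_toJordanDecomposition

theorem diff_sub_diff (p n p' n' : FiniteMeasure E) :
    diff p n - diff p' n' = diff (p + n') (n + p') := by
  simp only [diff_eq_sub, map_add]
  abel

theorem mass_eq_variation (s : SignedMeasure E) : mass s = s.variation Set.univ := by
  rw [mass, s.totalVariation_eq_variation]

theorem mass_toSigned (p : FiniteMeasure E) : mass (toSigned p) = p.mass := by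
  rw [mass_eq_variation, FiniteMeasure.ennreal_mass]
  exact congrArg (· Set.univ) (Measure.variation_toSignedMeasure (μ := (p : Measure E)))

theorem mass_add_le (s t : SignedMeasure E) : mass (s + t) ≤ mass s + mass t := by
  simp only [mass_eq_variation]
  exact VectorMeasure.variation_add_le Set.univ

theorem mass_smul (c : ℝ≥0) (s : SignedMeasure E) : mass (c • s) = c * mass s := by
  have : c • s = (c : ℝ) • s := rfl
  rw [this, mass_eq_variation, mass_eq_variation, VectorMeasure.variation_smul]
  simp

theorem mass_ne_top (s : SignedMeasure E) : mass s ≠ ∞ :=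
  measure_ne_top s.totalVariation Set.univ

end Mass

section RelaxedCost

variable {E : Type*} [MeasurableSpace E] [PseudoEMetricSpace E]

/-- The cost of transporting `z.1` to `z.2` through a plan `π` whose marginals need not be `z.1` and
`z.2`: the defects are paid at price `a` per unit of mass. Allowing signed `z` makes the domain a
vector space. -/
def relaxedCost (a b : ℝ≥0) (z : SignedMeasure E × SignedMeasure E) (π : FiniteMeasure (E × E)) :
    ℝ≥0∞ :=
  a * (mass (z.1 - toSigned (π.map Prod.fst)) + mass (z.2 - toSigned (π.map Prod.snd))) +
    b * ∫⁻ e, edist e.1 e.2 ∂(π : Measure (E × E))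

/-- The generalized Wasserstein cost of a pair of signed measures, the infimum of `relaxedCost` over
all plans. It agrees with `genW₁` on pairs of positive measures. -/
def relaxedW₁ (a b : ℝ≥0) (z : SignedMeasure E × SignedMeasure E) : ℝ≥0∞ :=
  ⨅ π, relaxedCost a b z π

variable (a b : ℝ≥0)

theorem relaxedCost_smul (c : ℝ≥0) (z : SignedMeasure E × SignedMeasure E)
    (π : FiniteMeasure (E × E)) :
    relaxedCost a b (c • z) (c • π) = c * relaxedCost a b z π := by
  have mass_eq (s : SignedMeasure E) (p : FiniteMeasure E) :
      mass (c • s - toSigned (c • p)) = c * mass (s - toSigned p) := by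
    rw [map_smul, ← mass_smul]
    exact congrArg mass (smul_sub c s (toSigned p)).symm
  simp only [relaxedCost, FiniteMeasure.map_smul, Prod.smul_fst, Prod.smul_snd, mass_eq,
    FiniteMeasure.toMeasure_smul, lintegral_smul_measure, ENNReal.smul_def, smul_eq_mul]
  ring

theorem relaxedCost_add_le (z w : SignedMeasure E × SignedMeasure E)
    (π ρ : FiniteMeasure (E × E)) :
    relaxedCost a b (z + w) (π + ρ) ≤ relaxedCost a b z π + relaxedCost a b w ρ := by
  have mass_le (s t : SignedMeasure E) (p q : FiniteMeasure E) :
      mass (s + t - toSigned (p + q)) ≤ mass (s - toSigned p) + mass (t - toSigned q) := by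
    rw [map_add, add_sub_add_comm]
    exact mass_add_le _ _
  calc relaxedCost a b (z + w) (π + ρ)
      ≤ a * (mass (z.1 - toSigned (π.map Prod.fst)) + mass (w.1 - toSigned (ρ.map Prod.fst)) +
          (mass (z.2 - toSigned (π.map Prod.snd)) + mass (w.2 - toSigned (ρ.map Prod.snd)))) +
        b * (∫⁻ e, edist e.1 e.2 ∂(π : Measure (E × E)) +
          ∫⁻ e, edist e.1 e.2 ∂(ρ : Measure (E × E))) := by
        rw [relaxedCost, FiniteMeasure.map_add measurable_fst, FiniteMeasure.map_add measurable_snd,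
          FiniteMeasure.toMeasure_add, lintegral_add_measure]
        gcongr <;> exact mass_le ..
    _ = relaxedCost a b z π + relaxedCost a b w ρ := by
        simp only [relaxedCost]
        ring

theorem relaxedW₁_le_mass (z : SignedMeasure E × SignedMeasure E) :
    relaxedW₁ a b z ≤ a * (mass z.1 + mass z.2) := by
  have map_zero (f : E × E → E) : (0 : FiniteMeasure (E × E)).map f = 0 :=
    Subtype.ext (Measure.map_zero f)
  exact (iInf_le _ 0).trans_eq (by simp [relaxedCost, map_zero])

theorem relaxedW₁_ne_top (z : SignedMeasure E × SignedMeasure E) : relaxedW₁ a b z ≠ ∞ :=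
  ne_top_of_le_ne_top (ENNReal.mul_ne_top ENNReal.coe_ne_top
    (ENNReal.add_ne_top.2 ⟨mass_ne_top _, mass_ne_top _⟩)) (relaxedW₁_le_mass a b z)

theorem relaxedW₁_smul_le (c : ℝ≥0) (z : SignedMeasure E × SignedMeasure E) :
    relaxedW₁ a b (c • z) ≤ c * relaxedW₁ a b z := by
  rw [relaxedW₁, relaxedW₁, ENNReal.mul_iInf (by simp)]
  exact le_iInf fun π ↦ (iInf_le _ (c • π)).trans_eq (relaxedCost_smul a b c z π)

theorem relaxedW₁_smul {c : ℝ≥0} (hc : c ≠ 0) (z : SignedMeasure E × SignedMeasure E) :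
    relaxedW₁ a b (c • z) = c * relaxedW₁ a b z := by
  refine (relaxedW₁_smul_le a b c z).antisymm ?_
  calc c * relaxedW₁ a b z = c * relaxedW₁ a b (c⁻¹ • c • z) := by rw [inv_smul_smul₀ hc]
    _ ≤ c * (c⁻¹ * relaxedW₁ a b (c • z)) := by grw [relaxedW₁_smul_le a b c⁻¹]
    _ = relaxedW₁ a b (c • z) := by
      rw [← mul_assoc, ← ENNReal.coe_mul, mul_inv_cancel₀ hc, ENNReal.coe_one, one_mul]

theorem relaxedW₁_add_le (z w : SignedMeasure E × SignedMeasure E) :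
    relaxedW₁ a b (z + w) ≤ relaxedW₁ a b z + relaxedW₁ a b w :=
  ENNReal.le_iInf_add_iInf fun π ρ ↦ (iInf_le _ (π + ρ)).trans (relaxedCost_add_le a b z w π ρ)

theorem exists_linear_le_relaxedW₁ (u w : SignedMeasure E) :
    ∃ Φ Ψ : SignedMeasure E →ₗ[ℝ] ℝ, Φ u + Ψ w = (relaxedW₁ a b (u, w)).toReal ∧
      ∀ u w, Φ u + Ψ w ≤ (relaxedW₁ a b (u, w)).toReal := by
  obtain ⟨g, g_eq, g_le⟩ := exists_linear_le_sublinear_eq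
    (fun z : SignedMeasure E × SignedMeasure E ↦ (relaxedW₁ a b z).toReal)
    (fun c hc z ↦ by
      lift c to ℝ≥0 using hc.le
      rw [← ENNReal.coe_toReal, ← ENNReal.toReal_mul]
      exact congrArg _ (relaxedW₁_smul a b (by exact_mod_cast hc.ne') z))
    (fun z w ↦ by
      rw [← ENNReal.toReal_add (relaxedW₁_ne_top a b z) (relaxedW₁_ne_top a b w)]
      exact ENNReal.toReal_mono (ENNReal.add_ne_top.2 ⟨relaxedW₁_ne_top a b z,
        relaxedW₁_ne_top a b w⟩) (relaxedW₁_add_le a b z w))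
    (u, w)
  have g_split (u w : SignedMeasure E) : g (u, 0) + g (0, w) = g (u, w) := by
    rw [← map_add, Prod.mk_add_mk, add_zero, zero_add]
  exact ⟨g.comp (.inl ..), g.comp (.inr ..), (g_split u w).trans g_eq,
    fun u w ↦ (g_split u w).trans_le (g_le (u, w))⟩

end RelaxedCost

section Plans

variable {E : Type*} [MeasurableSpace E]

theorem isFiniteMeasure_of_mem_plans {p q : FiniteMeasure E} {π : Measure (E × E)}
    (hπ : π ∈ plans p q) : IsFiniteMeasure π :=
  ⟨by
    rw [← Set.preimage_univ (f := Prod.fst), ← Measure.map_apply measurable_fst .univ, hπ.1]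
    exact measure_lt_top _ _⟩

theorem map_mem_plans (π : FiniteMeasure (E × E)) :
    (π : Measure (E × E)) ∈ plans (π.map Prod.fst) (π.map Prod.snd) :=
  ⟨rfl, rfl⟩

theorem plans_nonempty {p q : FiniteMeasure E} (h : p.mass = q.mass) : (plans p q).Nonempty := by
  rcases eq_or_ne p.mass 0 with hp | hp
  · obtain rfl := (FiniteMeasure.mass_zero_iff q).1 (h ▸ hp)
    obtain rfl := (FiniteMeasure.mass_zero_iff p).1 hp
    exact ⟨0, Measure.map_zero _, Measure.map_zero _⟩
  have map_fst : (p.mass⁻¹ • p.prod q).map Prod.fst = p := by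
    rw [FiniteMeasure.map_smul, FiniteMeasure.map_fst_prod, ← FiniteMeasure.mass, ← h,
      inv_smul_smul₀ hp]
  have map_snd : (p.mass⁻¹ • p.prod q).map Prod.snd = q := by
    rw [FiniteMeasure.map_smul, FiniteMeasure.map_snd_prod, ← FiniteMeasure.mass,
      inv_smul_smul₀ hp]
  exact ⟨_, congrArg Subtype.val map_fst, congrArg Subtype.val map_snd⟩

theorem mass_map {F : Type*} [MeasurableSpace F] (p : FiniteMeasure E) {f : E → F}
    (hf : Measurable f) : (p.map f).mass = p.mass := by
  rw [FiniteMeasure.mass, FiniteMeasure.map_apply p hf .univ, Set.preimage_univ,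
    FiniteMeasure.mass]

variable [PseudoEMetricSpace E] (a b : ℝ≥0)

theorem genW₁_le_relaxedCost (p q : FiniteMeasure E) (π : FiniteMeasure (E × E)) :
    genW₁ a b p q ≤ relaxedCost a b (toSigned p, toSigned q) π := by
  have mass_eq : (π.map Prod.fst).mass = (π.map Prod.snd).mass := by
    rw [mass_map π measurable_fst, mass_map π measurable_snd]
  refine iInf_le_of_le (π.map Prod.fst) <| iInf₂_le_of_le (π.map Prod.snd) mass_eq ?_
  exact add_le_add_right (mul_le_mul_right (iInf₂_le _ (map_mem_plans π)) _) _

theorem relaxedW₁_le_of_mem_plans (p q : FiniteMeasure E) {p' q' : FiniteMeasure E}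
    {π : Measure (E × E)} (hπ : π ∈ plans p' q') :
    relaxedW₁ a b (toSigned p, toSigned q) ≤
      a * (mass (diff p p') + mass (diff q q')) + b * ∫⁻ e, edist e.1 e.2 ∂π := by
  have := isFiniteMeasure_of_mem_plans hπ
  have map_fst : FiniteMeasure.map (⟨π, this⟩ : FiniteMeasure (E × E)) Prod.fst = p' :=
    Subtype.ext hπ.1
  have map_snd : FiniteMeasure.map (⟨π, this⟩ : FiniteMeasure (E × E)) Prod.snd = q' :=
    Subtype.ext hπ.2
  refine (iInf_le _ ⟨π, this⟩).trans_eq ?_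
  simp only [relaxedCost, map_fst, map_snd, diff_eq_sub, FiniteMeasure.toMeasure_mk]

theorem genW₁_eq_relaxedW₁ (p q : FiniteMeasure E) :
    genW₁ a b p q = relaxedW₁ a b (toSigned p, toSigned q) := by
  refine le_antisymm (le_iInf fun π ↦ genW₁_le_relaxedCost a b p q π)
    (le_iInf₂ fun p' q' ↦ le_iInf fun h ↦ ?_)
  have : Nonempty (plans p' q') := (plans_nonempty h).to_subtype
  rw [W₁, iInf_subtype', ENNReal.mul_iInf (by simp), ENNReal.add_iInf]
  exact le_iInf fun π ↦ relaxedW₁_le_of_mem_plans a b p q π.2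

theorem genW₁_le_mass (p q : FiniteMeasure E) : genW₁ a b p q ≤ a * (p.mass + q.mass) := by
  rw [genW₁_eq_relaxedW₁, ← mass_toSigned, ← mass_toSigned]
  exact relaxedW₁_le_mass a b (toSigned p, toSigned q)

theorem genW₁_ne_top (p q : FiniteMeasure E) : genW₁ a b p q ≠ ∞ := by
  rw [genW₁_eq_relaxedW₁]
  exact relaxedW₁_ne_top a b (toSigned p, toSigned q)

end Plans

section WeakDuality

variable {E : Type*} [MeasurableSpace E] [PseudoEMetricSpace E]

/-- The bounded continuous functions with `‖φ‖_∞ ≤ a` and Lipschitz constant at most `b`, the test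
functions dual to `genW₁ a b`. -/
def lipBall (E : Type*) [PseudoEMetricSpace E] (a b : ℝ≥0) : Set (E →ᵇ ℝ) :=
  {φ | ‖φ‖ ≤ a ∧ LipschitzWith b φ}

/-- The values `∫ φ ds` over the test functions of `lipBall`; for `a = b = 1` these are the
`blValues`. -/
def lipValues (a b : ℝ≥0) (s : SignedMeasure E) : Set ℝ :=
  (fun φ : E →ᵇ ℝ ↦ ∫ᵛ x, φ x ∂<•s) '' lipBall E a b

theorem blValues_eq_lipValues (s : SignedMeasure E) : blValues s = lipValues 1 1 s :=
  Set.ext fun _ ↦ exists_congr fun _ ↦ and_congr_right fun _ ↦ eq_comm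

variable [OpensMeasurableSpace E]

theorem integrable_boundedContinuousFunction (φ : E →ᵇ ℝ) (s : SignedMeasure E) :
    s.Integrable φ := by
  rw [VectorMeasure.Integrable, ← s.totalVariation_eq_variation]
  exact φ.integrable _

/-- Integration of a bounded continuous function, as a linear functional on signed measures. -/
def integralₗ (φ : E →ᵇ ℝ) : SignedMeasure E →ₗ[ℝ] ℝ where
  toFun s := ∫ᵛ x, φ x ∂<•s
  map_add' s t := VectorMeasure.integral_add_vectorMeasure
    (integrable_boundedContinuousFunction φ s) (integrable_boundedContinuousFunction φ t)
  map_smul' c _ := VectorMeasure.integral_smul_vectorMeasure φ c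

theorem integralₗ_toSigned (φ : E →ᵇ ℝ) (p : FiniteMeasure E) :
    integralₗ φ (toSigned p) = ∫ x, φ x ∂(p : Measure E) :=
  VectorMeasure.integral_toSignedMeasure

theorem integralₗ_neg (φ : E →ᵇ ℝ) (s : SignedMeasure E) : integralₗ (-φ) s = -integralₗ φ s :=
  VectorMeasure.integral_fun_neg s _ φ

theorem enorm_integralₗ_le (φ : E →ᵇ ℝ) (s : SignedMeasure E) :
    ‖integralₗ φ s‖ₑ ≤ ‖φ‖ₑ * mass s :=
  calc ‖integralₗ φ s‖ₑ
    _ ≤ ∫⁻ x, ‖φ x‖ₑ ∂s.variation := by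
      refine (VectorMeasure.enorm_integral_le_lintegral_enorm_transpose).trans_eq ?_
      rw [VectorMeasure.variation_transpose_lsmul_flip]
    _ ≤ ‖φ‖ₑ * mass s := by
      rw [mass_eq_variation, ← lintegral_const]
      exact lintegral_mono fun x ↦ by simpa only [enorm_le_iff_norm_le] using φ.norm_coe_le_norm x

theorem enorm_integralₗ_map_sub_map_le {b : ℝ≥0} {φ : E →ᵇ ℝ} (hφ : LipschitzWith b φ)
    (π : FiniteMeasure (E × E)) :
    ‖integralₗ φ (toSigned (π.map Prod.fst)) - integralₗ φ (toSigned (π.map Prod.snd))‖ₑ ≤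
      b * ∫⁻ e, edist e.1 e.2 ∂(π : Measure (E × E)) := by
  have φ_meas : StronglyMeasurable φ := φ.continuous.measurable.stronglyMeasurable
  have integrable_comp {f : E × E → E} (hf : Measurable f) :
      Integrable (fun e ↦ φ (f e)) (π : Measure (E × E)) :=
    (integrable_map_measure φ_meas.aestronglyMeasurable hf.aemeasurable).1 (φ.integrable _)
  have integral_map {f : E × E → E} (hf : Measurable f) :
      integralₗ φ (toSigned (π.map f)) = ∫ e, φ (f e) ∂(π : Measure (E × E)) := by
    rw [integralₗ_toSigned, FiniteMeasure.toMeasure_map,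
      integral_map hf.aemeasurable φ_meas.aestronglyMeasurable]
  rw [integral_map measurable_fst, integral_map measurable_snd,
    ← integral_sub (integrable_comp measurable_fst) (integrable_comp measurable_snd)]
  refine (enorm_integral_le_lintegral_enorm _).trans ?_
  rw [← lintegral_const_mul' _ _ ENNReal.coe_ne_top]
  exact lintegral_mono fun e ↦ by simpa only [← edist_eq_enorm_sub] using hφ e.1 e.2

theorem enorm_integralₗ_sub_le_relaxedCost {a b : ℝ≥0} {φ : E →ᵇ ℝ} (hφ : φ ∈ lipBall E a b)
    (u w : SignedMeasure E) (π : FiniteMeasure (E × E)) :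
    ‖integralₗ φ u - integralₗ φ w‖ₑ ≤ relaxedCost a b (u, w) π := by
  set p := toSigned (π.map Prod.fst)
  set q := toSigned (π.map Prod.snd)
  have le_mass (s : SignedMeasure E) : ‖integralₗ φ s‖ₑ ≤ a * mass s := by
    refine (enorm_integralₗ_le φ s).trans ?_
    gcongr
    exact_mod_cast hφ.1
  calc ‖integralₗ φ u - integralₗ φ w‖ₑ
    _ = ‖integralₗ φ (u - p) - integralₗ φ (w - q) + (integralₗ φ p - integralₗ φ q)‖ₑ := by
      rw [map_sub, map_sub]
      congr 1
      ring
    _ ≤ ‖integralₗ φ (u - p)‖ₑ + ‖integralₗ φ (w - q)‖ₑ + ‖integralₗ φ p - integralₗ φ q‖ₑ := by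
      grw [enorm_add_le, enorm_sub_le]
    _ ≤ a * mass (u - p) + a * mass (w - q) + b * ∫⁻ e, edist e.1 e.2 ∂(π : Measure (E × E)) := by
      grw [le_mass, le_mass, enorm_integralₗ_map_sub_map_le hφ.2 π]
    _ = relaxedCost a b (u, w) π := by rw [← mul_add, relaxedCost]

theorem integralₗ_diff_le_genW₁ {a b : ℝ≥0} {φ : E →ᵇ ℝ} (hφ : φ ∈ lipBall E a b)
    (p q : FiniteMeasure E) : integralₗ φ (diff p q) ≤ (genW₁ a b p q).toReal := by
  rw [diff_eq_sub, map_sub]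
  refine (le_abs_self _).trans ?_
  rw [← Real.norm_eq_abs, ← toReal_enorm, genW₁_eq_relaxedW₁]
  exact ENNReal.toReal_mono (relaxedW₁_ne_top a b _)
    (le_iInf fun π ↦ enorm_integralₗ_sub_le_relaxedCost hφ _ _ π)

end WeakDuality

section Concentrated

variable {E : Type*} [MeasurableSpace E] [PseudoMetricSpace E]

/-- `p` gives no mass to the complement of the closed ball of radius `r` about `x`. Concentrated
measures replace Dirac masses: the functionals of the dual problem are not assumed to be continuous,
hence not determined by their values on Dirac masses. -/
def IsConcentrated (p : FiniteMeasure E) (x : E) (r : ℝ≥0) : Prop :=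
  ∀ᵐ y ∂(p : Measure E), nndist y x ≤ r

theorem IsConcentrated.smul {p : FiniteMeasure E} {x : E} {r : ℝ≥0} (hp : IsConcentrated p x r)
    (c : ℝ≥0) : IsConcentrated (c • p) x r :=
  Measure.ae_smul_measure hp c

theorem IsConcentrated.of_nndist {p : FiniteMeasure E} {x y : E} {r : ℝ≥0}
    (hp : IsConcentrated p x r) : IsConcentrated p y (r + nndist x y) :=
  hp.mono fun z hz ↦ (nndist_triangle z x y).trans (by gcongr)

theorem genW₁_le_of_isConcentrated (a b : ℝ≥0) {p q : FiniteMeasure E} (h : p.mass = q.mass)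
    {x : E} {r r' : ℝ≥0} (hp : IsConcentrated p x r) (hq : IsConcentrated q x r') :
    genW₁ a b p q ≤ b * ((r + r') * p.mass) := by
  obtain ⟨π, hπ⟩ := plans_nonempty h
  have hp' : ∀ᵐ e ∂π, nndist e.1 x ≤ r :=
    ae_of_ae_map measurable_fst.aemeasurable (by rwa [hπ.1])
  have hq' : ∀ᵐ e ∂π, nndist e.2 x ≤ r' :=
    ae_of_ae_map measurable_snd.aemeasurable (by rwa [hπ.2])
  have edist_le : ∀ᵐ e ∂π, edist e.1 e.2 ≤ (r + r' : ℝ≥0) := by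
    filter_upwards [hp', hq'] with e h₁ h₂
    rw [edist_nndist]
    exact_mod_cast (nndist_triangle_right e.1 e.2 x).trans (add_le_add h₁ h₂)
  have π_univ : π Set.univ = p.mass := by
    rw [FiniteMeasure.ennreal_mass, ← hπ.1, Measure.map_apply measurable_fst .univ,
      Set.preimage_univ]
  calc genW₁ a b p q
    _ ≤ a * (mass (diff p p) + mass (diff q q)) + b * ∫⁻ e, edist e.1 e.2 ∂π := by
      rw [genW₁_eq_relaxedW₁]
      exact relaxedW₁_le_of_mem_plans a b p q hπ
    _ = b * ∫⁻ e, edist e.1 e.2 ∂π := by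
      simp [diff_eq_sub, mass, SignedMeasure.totalVariation_zero]
    _ ≤ b * ((r + r') * p.mass) := by
      gcongr
      refine (lintegral_mono_ae edist_le).trans_eq ?_
      rw [lintegral_const, π_univ, ENNReal.coe_add]

theorem abs_integral_sub_le_of_isConcentrated [OpensMeasurableSpace E] {b : ℝ≥0} {f : E →ᵇ ℝ}
    (hf : LipschitzWith b f) {p : FiniteMeasure E} (h : p.mass = 1) {x : E} {r : ℝ≥0}
    (hp : IsConcentrated p x r) : |∫ y, f y ∂(p : Measure E) - f x| ≤ b * r := by
  have real_univ : (p : Measure E).real Set.univ = 1 := congrArg NNReal.toReal h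
  have integral_sub_const :
      ∫ y, (f y - f x) ∂(p : Measure E) = ∫ y, f y ∂(p : Measure E) - f x := by
    rw [integral_sub (f.integrable _) (integrable_const _), integral_const, real_univ, one_smul]
  have f_near : ∀ᵐ y ∂(p : Measure E), ‖f y - f x‖ ≤ b * r := by
    filter_upwards [hp] with y hy
    rw [← dist_eq_norm]
    exact (hf.dist_le_mul y x).trans (by gcongr; exact hy)
  simpa [integral_sub_const, real_univ] using norm_integral_le_of_norm_le_const f_near

end Concentrated

section Localization

variable {E : Type*} [MeasurableSpace E] {Λ : SignedMeasure E →ₗ[ℝ] ℝ}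

theorem apply_biUnion_restrict_le {p : FiniteMeasure E} {C : ℝ} {ι : Type*} {A : ι → Set E}
    (hA : ∀ i, MeasurableSet (A i)) (hdisj : Pairwise (Function.onFun Disjoint A))
    (hΛ : ∀ i, Λ (toSigned (p.restrict (A i))) ≤ C * p (A i)) (s : Finset ι) :
    Λ (toSigned (p.restrict (⋃ i ∈ s, A i))) ≤ C * p (⋃ i ∈ s, A i) := by
  have p_biUnion : (p (⋃ i ∈ s, A i) : ℝ) = ∑ i ∈ s, (p (A i) : ℝ) :=
    measureReal_biUnion_finset (hdisj.set_pairwise _) fun i _ ↦ hA i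
  rw [FiniteMeasure.restrict_biUnion_finset (hdisj.set_pairwise _) hA, map_sum, map_sum, p_biUnion,
    Finset.mul_sum]
  exact Finset.sum_le_sum fun i _ ↦ hΛ i

/- `Λ` need not be continuous: it is `hK` that makes the tail of the partition negligible. -/
theorem apply_le_of_partition {p : FiniteMeasure E} {C K : ℝ} {A : ℕ → Set E}
    (hA : ∀ n, MeasurableSet (A n)) (hdisj : Pairwise (Function.onFun Disjoint A))
    (hcover : ⋃ n, A n = Set.univ) (hK : ∀ q, Λ (toSigned q) ≤ K * q.mass)
    (hΛ : ∀ n, Λ (toSigned (p.restrict (A n))) ≤ C * p (A n)) :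
    Λ (toSigned p) ≤ C * p.mass := by
  have apply_le (n : ℕ) : Λ (toSigned p) ≤
      C * p (Set.accumulate A n) + K * (p.mass - p (Set.accumulate A n)) := by
    set B := Set.accumulate A n with B_def
    have B_eq : B = ⋃ i ∈ Finset.Iic n, A i := by simp [B_def, Set.accumulate]
    have B_meas : MeasurableSet B := B_eq ▸ Finset.measurableSet_biUnion _ fun i _ ↦ hA i
    have p_split : p = p.restrict B + p.restrict Bᶜ := by
      rw [← FiniteMeasure.restrict_union disjoint_compl_right B_meas.compl, Set.union_compl_self,
        FiniteMeasure.restrict_univ]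
    have on_B : Λ (toSigned (p.restrict B)) ≤ C * p B :=
      B_eq ▸ apply_biUnion_restrict_le hA hdisj hΛ (Finset.Iic n)
    have on_compl : Λ (toSigned (p.restrict Bᶜ)) ≤ K * (p.mass - p B) := by
      have := hK (p.restrict Bᶜ)
      rw [FiniteMeasure.restrict_mass] at this
      exact this.trans_eq (congrArg (K * ·) (measureReal_compl B_meas))
    calc Λ (toSigned p) = Λ (toSigned (p.restrict B)) + Λ (toSigned (p.restrict Bᶜ)) := by
          rw [← map_add, ← map_add, ← p_split]
      _ ≤ _ := add_le_add on_B on_compl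
  have accumulate_tendsto :
      Filter.Tendsto (fun n ↦ (p (Set.accumulate A n) : ℝ)) .atTop (nhds p.mass) := by
    have := FiniteMeasure.tendsto_measure_iUnion_accumulate (μ := p) (f := A)
    rw [hcover] at this
    exact NNReal.tendsto_coe.2 this
  have bound_tendsto := (accumulate_tendsto.const_mul C).add
    ((accumulate_tendsto.const_sub (p.mass : ℝ)).const_mul K)
  rw [sub_self, mul_zero, add_zero] at bound_tendsto
  exact ge_of_tendsto' bound_tendsto apply_le

variable [PseudoMetricSpace E]

theorem apply_le_mul_mass_of_isConcentrated {C : ℝ} {x : E} {r : ℝ≥0}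
    (hΛ : ∀ p, p.mass = 1 → IsConcentrated p x r → Λ (toSigned p) ≤ C) {p : FiniteMeasure E}
    (hp : IsConcentrated p x r) : Λ (toSigned p) ≤ C * p.mass := by
  rcases eq_or_ne p 0 with rfl | hp₀
  · simp
  have mass_ne : p.mass ≠ 0 := (FiniteMeasure.mass_nonzero_iff p).2 hp₀
  have mass_smul_inv : (p.mass⁻¹ • p).mass = 1 := by
    simpa [FiniteMeasure.mass] using inv_mul_cancel₀ mass_ne
  have Λ_smul : Λ (toSigned (p.mass⁻¹ • p)) = (p.mass : ℝ)⁻¹ * Λ (toSigned p) := by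
    rw [map_smul]
    exact Λ.map_smul_of_tower p.mass⁻¹ (toSigned p)
  have := hΛ (p.mass⁻¹ • p) mass_smul_inv (hp.smul p.mass⁻¹)
  rwa [Λ_smul, inv_mul_le_iff₀ (by positivity), mul_comm] at this

theorem apply_nonpos_of_isConcentrated [OpensMeasurableSpace E] [SeparableSpace E] {K C : ℝ}
    (hK : ∀ p, Λ (toSigned p) ≤ K * p.mass)
    (hC : ∀ p x r, p.mass = 1 → IsConcentrated p x r → Λ (toSigned p) ≤ C * r)
    (p : FiniteMeasure E) : Λ (toSigned p) ≤ 0 := by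
  have apply_le (r : ℝ≥0) (hr : 0 < r) : Λ (toSigned p) ≤ C * r * p.mass := by
    obtain ⟨A, hA, hbdd, hdiam, hcover, hdisj⟩ :=
      SeparableSpace.exists_measurable_partition_diam_le E (NNReal.coe_pos.2 hr)
    refine apply_le_of_partition hA hdisj hcover hK fun n ↦ ?_
    rcases (A n).eq_empty_or_nonempty with hn | ⟨x, hx⟩
    · have restrict_empty : p.restrict ∅ = 0 := Subtype.ext Measure.restrict_empty
      simp [hn, restrict_empty, ← FiniteMeasure.restrict_mass]
    have restrict_concentrated : IsConcentrated (p.restrict (A n)) x r :=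
      ae_restrict_of_forall_mem (hA n) fun y hy ↦
        (Metric.dist_le_diam_of_mem (hbdd n) hy hx).trans (hdiam n)
    simpa only [FiniteMeasure.restrict_mass] using
      apply_le_mul_mass_of_isConcentrated (fun q ↦ hC q x r) restrict_concentrated
  have bound_tendsto : Filter.Tendsto (fun r : ℝ≥0 ↦ C * r * p.mass) (nhdsWithin 0 (Set.Ioi 0))
      (nhds 0) := by
    refine Filter.Tendsto.mono_left ?_ nhdsWithin_le_nhds
    exact Continuous.tendsto' (by fun_prop) _ _ (by simp)
  exact ge_of_tendsto bound_tendsto (eventually_nhdsWithin_of_forall apply_le)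

end Localization

section DualPair

variable {E : Type*} [MeasurableSpace E] [PseudoEMetricSpace E] {a b : ℝ≥0}
  {Φ Ψ : SignedMeasure E →ₗ[ℝ] ℝ}

/-- Feasibility of a pair of linear functionals in the dual problem. No continuity is required, so
that such pairs are supplied by the Hahn–Banach theorem. -/
def IsDualPair (a b : ℝ≥0) (Φ Ψ : SignedMeasure E →ₗ[ℝ] ℝ) : Prop :=
  ∀ p q, Φ (toSigned p) + Ψ (toSigned q) ≤ (genW₁ a b p q).toReal

theorem exists_isDualPair_eq (a b : ℝ≥0) (p q : FiniteMeasure E) :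
    ∃ Φ Ψ : SignedMeasure E →ₗ[ℝ] ℝ, IsDualPair a b Φ Ψ ∧
      Φ (toSigned p) + Ψ (toSigned q) = (genW₁ a b p q).toReal := by
  obtain ⟨Φ, Ψ, h_eq, h_le⟩ := exists_linear_le_relaxedW₁ a b (toSigned p) (toSigned q)
  refine ⟨Φ, Ψ, fun p q ↦ ?_, ?_⟩
  · rw [genW₁_eq_relaxedW₁]
    exact h_le (toSigned p) (toSigned q)
  · rw [genW₁_eq_relaxedW₁, h_eq]

theorem IsDualPair.add_le_mass (h : IsDualPair a b Φ Ψ) (p q : FiniteMeasure E) :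
    Φ (toSigned p) + Ψ (toSigned q) ≤ a * (p.mass + q.mass) :=
  (h p q).trans <| ENNReal.toReal_le_of_le_ofReal (by positivity) <| by
    have := genW₁_le_mass a b p q
    rwa [← ENNReal.coe_add, ← ENNReal.coe_mul, ← ENNReal.ofReal_coe_nnreal] at this

theorem IsDualPair.left_le_mass (h : IsDualPair a b Φ Ψ) (p : FiniteMeasure E) :
    Φ (toSigned p) ≤ a * p.mass := by
  simpa using h.add_le_mass p 0

theorem IsDualPair.right_le_mass (h : IsDualPair a b Φ Ψ) (q : FiniteMeasure E) :
    Ψ (toSigned q) ≤ a * q.mass := by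
  simpa using h.add_le_mass 0 q

end DualPair

section Potential

variable {E : Type*} [MeasurableSpace E] [PseudoMetricSpace E] {a b : ℝ≥0}
  {Φ Ψ : SignedMeasure E →ₗ[ℝ] ℝ}

theorem IsDualPair.add_le_of_isConcentrated (h : IsDualPair a b Φ Ψ) {p q : FiniteMeasure E}
    (hp₁ : p.mass = 1) (hq₁ : q.mass = 1) {x : E} {r r' : ℝ≥0} (hp : IsConcentrated p x r)
    (hq : IsConcentrated q x r') : Φ (toSigned p) + Ψ (toSigned q) ≤ b * (r + r') :=
  (h p q).trans <| ENNReal.toReal_le_of_le_ofReal (by positivity) <| by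
    have := genW₁_le_of_isConcentrated a b (hp₁.trans hq₁.symm) hp hq
    rwa [hp₁, ENNReal.coe_one, mul_one, ← ENNReal.coe_add, ← ENNReal.coe_mul,
      ← ENNReal.ofReal_coe_nnreal] at this

/-- The numbers whose infimum is `potential a b Ψ x`. -/
def potentialValues (a b : ℝ≥0) (Ψ : SignedMeasure E →ₗ[ℝ] ℝ) (x : E) : Set ℝ :=
  insert (a : ℝ) {t | ∃ (q : FiniteMeasure E) (r : ℝ≥0), q.mass = 1 ∧ IsConcentrated q x r ∧
    t = b * r - Ψ (toSigned q)}

/-- The `b`-Lipschitz potential generated by `-Ψ`, capped at `a`. If `Ψ` were integration of a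
function `ψ`, this would be the `c`-transform `min a (⨅ y, b * dist y x - ψ y)`. -/
def potential (a b : ℝ≥0) (Ψ : SignedMeasure E →ₗ[ℝ] ℝ) (x : E) : ℝ :=
  sInf (potentialValues a b Ψ x)

theorem neg_le_of_mem_potentialValues (hΨ : ∀ q, Ψ (toSigned q) ≤ a * q.mass) {x : E} {t : ℝ}
    (ht : t ∈ potentialValues a b Ψ x) : -a ≤ t := by
  rcases ht with rfl | ⟨q, r, hq₁, -, rfl⟩
  · exact neg_le_self a.2
  · have := hΨ q
    rw [hq₁, NNReal.coe_one, mul_one] at this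
    linarith [show (0 : ℝ) ≤ b * r by positivity]

theorem bddBelow_potentialValues (hΨ : ∀ q, Ψ (toSigned q) ≤ a * q.mass) (x : E) :
    BddBelow (potentialValues a b Ψ x) :=
  ⟨-a, fun _ ↦ neg_le_of_mem_potentialValues hΨ⟩

theorem abs_potential_le (hΨ : ∀ q, Ψ (toSigned q) ≤ a * q.mass) (x : E) :
    |potential a b Ψ x| ≤ a :=
  abs_le.2 ⟨le_csInf (Set.insert_nonempty _ _) fun _ ↦ neg_le_of_mem_potentialValues hΨ,
    csInf_le (bddBelow_potentialValues hΨ x) (Set.mem_insert _ _)⟩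

theorem lipschitzWith_potential (hΨ : ∀ q, Ψ (toSigned q) ≤ a * q.mass) :
    LipschitzWith b (potential a b Ψ) := by
  refine LipschitzWith.of_le_add_mul b fun x y ↦ sub_le_iff_le_add.1 <|
    le_csInf (Set.insert_nonempty _ _) ?_
  rintro _ (rfl | ⟨q, r, hq₁, hq, rfl⟩)
  · have := (abs_le.1 (abs_potential_le (b := b) hΨ x)).2
    linarith [show 0 ≤ b * dist x y by positivity]
  · have : potential a b Ψ x ≤ b * (r + nndist y x : ℝ≥0) - Ψ (toSigned q) :=
      csInf_le (bddBelow_potentialValues hΨ x) (.inr ⟨q, _, hq₁, hq.of_nndist, rfl⟩)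
    rw [NNReal.coe_add, coe_nndist, dist_comm] at this
    linarith

theorem potential_le_of_isConcentrated (hΨ : ∀ q, Ψ (toSigned q) ≤ a * q.mass)
    {q : FiniteMeasure E} (hq₁ : q.mass = 1) {x : E} {r : ℝ≥0} (hq : IsConcentrated q x r) :
    potential a b Ψ x ≤ b * r - Ψ (toSigned q) :=
  csInf_le (bddBelow_potentialValues hΨ x) (.inr ⟨q, r, hq₁, hq, rfl⟩)

theorem IsDualPair.sub_le_potential (h : IsDualPair a b Φ Ψ) {p : FiniteMeasure E}
    (hp₁ : p.mass = 1) {x : E} {r : ℝ≥0} (hp : IsConcentrated p x r) :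
    Φ (toSigned p) - b * r ≤ potential a b Ψ x := by
  refine le_csInf (Set.insert_nonempty _ _) ?_
  rintro _ (rfl | ⟨q, r', hq₁, hq, rfl⟩)
  · have := h.left_le_mass p
    rw [hp₁, NNReal.coe_one, mul_one] at this
    linarith [show (0 : ℝ) ≤ b * r by positivity]
  · linarith [h.add_le_of_isConcentrated hp₁ hq₁ hp hq]

theorem apply_le_integralₗ_of_isConcentrated [OpensMeasurableSpace E] [SeparableSpace E]
    {Λ : SignedMeasure E →ₗ[ℝ] ℝ} {f : E →ᵇ ℝ} (hf : LipschitzWith b f) {K : ℝ}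
    (hK : ∀ p, Λ (toSigned p) ≤ K * p.mass)
    (hΛ : ∀ p x r, p.mass = 1 → IsConcentrated p x r → Λ (toSigned p) ≤ f x + b * r)
    (p : FiniteMeasure E) : Λ (toSigned p) ≤ integralₗ f (toSigned p) := by
  refine sub_nonpos.1 (apply_nonpos_of_isConcentrated (Λ := Λ - integralₗ f) (K := K + ‖f‖)
    (C := 2 * b) (fun p ↦ ?_) (fun p x r hp₁ hp ↦ ?_) p)
  · have := (abs_le.1 (f.norm_integral_le_mul_norm (p : Measure E))).1
    rw [LinearMap.sub_apply, integralₗ_toSigned]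
    rw [show (p : Measure E).real Set.univ = p.mass from rfl] at this
    linarith [hK p]
  · have := (abs_le.1 (abs_integral_sub_le_of_isConcentrated hf hp₁ hp)).1
    rw [LinearMap.sub_apply, integralₗ_toSigned]
    linarith [hΛ p x r hp₁ hp]

theorem IsDualPair.exists_le_integralₗ [OpensMeasurableSpace E] [SeparableSpace E]
    (h : IsDualPair a b Φ Ψ) :
    ∃ f ∈ lipBall E a b, ∀ p,
      Φ (toSigned p) ≤ integralₗ f (toSigned p) ∧ Ψ (toSigned p) ≤ -integralₗ f (toSigned p) := by
  have f_lip := lipschitzWith_potential (b := b) h.right_le_mass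
  let f : E →ᵇ ℝ := .ofNormedAddCommGroup (potential a b Ψ) f_lip.continuous a
    (abs_potential_le h.right_le_mass)
  refine ⟨f, ⟨BoundedContinuousFunction.norm_ofNormedAddCommGroup_le _ a.2 _, f_lip⟩,
    fun p ↦ ⟨?_, ?_⟩⟩
  · exact apply_le_integralₗ_of_isConcentrated f_lip h.left_le_mass
      (fun p x r hp₁ hp ↦ sub_le_iff_le_add.1 (h.sub_le_potential hp₁ hp)) p
  · rw [← integralₗ_neg]
    exact apply_le_integralₗ_of_isConcentrated (f := -f) f_lip.neg h.right_le_mass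
      (fun p x r hp₁ hp ↦ by
        have := potential_le_of_isConcentrated (b := b) h.right_le_mass hp₁ hp
        change Ψ (toSigned p) ≤ -potential a b Ψ x + b * r
        linarith) p

end Potential

section Duality

variable {E : Type*} [MeasurableSpace E] [PseudoMetricSpace E] [OpensMeasurableSpace E]
  [SeparableSpace E] (a b : ℝ≥0)

theorem isGreatest_lipValues_diff (p q : FiniteMeasure E) :
    IsGreatest (lipValues a b (diff p q)) (genW₁ a b p q).toReal := by
  obtain ⟨Φ, Ψ, h, h_eq⟩ := exists_isDualPair_eq a b p q
  obtain ⟨f, hf, f_le⟩ := h.exists_le_integralₗ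
  refine ⟨⟨f, hf, (integralₗ_diff_le_genW₁ hf p q).antisymm ?_⟩, ?_⟩
  · rw [diff_eq_sub, map_sub, ← h_eq]
    exact add_le_add (f_le p).1 (f_le q).2
  · rintro _ ⟨φ, hφ, rfl⟩
    exact integralₗ_diff_le_genW₁ hφ p q

theorem genW₁_eq_of_diff_eq {p q p' q' : FiniteMeasure E} (h : diff p q = diff p' q') :
    genW₁ a b p q = genW₁ a b p' q' := by
  have := isGreatest_lipValues_diff a b p q
  rw [h] at this
  exact (ENNReal.toReal_eq_toReal_iff' (genW₁_ne_top a b p q) (genW₁_ne_top a b p' q')).1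
    (this.unique (isGreatest_lipValues_diff a b p' q'))

theorem isGreatest_lipValues_sub (μ ν : SignedMeasure E) :
    IsGreatest (lipValues a b (μ - ν)) (signedW₁ a b μ ν).toReal := by
  have := isGreatest_lipValues_diff a b (posPart μ + negPart ν) (negPart μ + posPart ν)
  rwa [← diff_sub_diff, diff_posPart_negPart, diff_posPart_negPart] at this

end Duality

end SignedWasserstein

end

open SignedWasserstein in
theorem proposition23_general {E : Type*} [PseudoMetricSpace E] [TopologicalSpace.SeparableSpace E]
    [MeasurableSpace E] [OpensMeasurableSpace E] (a b : ℝ≥0) (μ ν : SignedMeasure E) :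
    (∀ μp μm νp νm : FiniteMeasure E, μ = diff μp μm → ν = diff νp νm →
      signedW₁ a b μ ν = genW₁ a b (μp + νm) (μm + νp)) ∧
    signedW₁ a b μ ν ≠ ∞ ∧
    IsGreatest (lipValues a b (μ - ν)) (signedW₁ a b μ ν).toReal ∧
    normW₁ a b μ ≠ ∞ ∧
    IsGreatest (lipValues a b μ) (normW₁ a b μ).toReal := by
  refine ⟨fun μp μm νp νm hμ hν ↦ genW₁_eq_of_diff_eq a b ?_, genW₁_ne_top a b _ _,
    isGreatest_lipValues_sub a b μ ν, genW₁_ne_top a b _ _, ?_⟩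
  · rw [← diff_sub_diff, ← diff_sub_diff, diff_posPart_negPart, diff_posPart_negPart, hμ, hν]
  · simpa only [normW₁, sub_zero] using isGreatest_lipValues_sub a b μ 0

/-- Kantorovich duality. The first clause says that `𝕎₁^{1,1}(μ, ν)` can be computed with any
decompositions of `μ` and `ν` into differences of finite positive measures. -/
theorem proposition23 (d : ℕ) (μ ν : SignedMeasure (EuclideanSpace ℝ (Fin d))) :
    (∀ μp μm νp νm : FiniteMeasure (EuclideanSpace ℝ (Fin d)),
      μ = SignedWasserstein.diff μp μm → ν = SignedWasserstein.diff νp νm →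
        SignedWasserstein.signedW₁ 1 1 μ ν =
          SignedWasserstein.genW₁ 1 1 (μp + νm) (μm + νp)) ∧
    SignedWasserstein.signedW₁ 1 1 μ ν ≠ ∞ ∧
    IsLUB (SignedWasserstein.blValues (μ - ν)) (SignedWasserstein.signedW₁ 1 1 μ ν).toReal ∧
    SignedWasserstein.normW₁ 1 1 μ ≠ ∞ ∧
    IsLUB (SignedWasserstein.blValues μ) (SignedWasserstein.normW₁ 1 1 μ).toReal := by
  simp only [SignedWasserstein.blValues_eq_lipValues]
  obtain ⟨h₁, h₂, h₃, h₄, h₅⟩ := proposition23_general 1 1 μ ν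
  exact ⟨h₁, h₂, h₃.isLUB, h₄, h₅.isLUB⟩
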